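/- Let $K$ be a compact Hausdorff space and let $I_1, J_1, I_2, J_2$ be closed ideals of the C*-algebra $C(K)$ of continuous complex-valued functions on $K$. For closed two-sided ideals $I, J$ of a C*-algebra $A$, write $I \subset\subset J$ ($I$ is compactly contained in $J$) if $I \subseteq J$ and there is a compact self-adjoint endomorphism $b$ of the Hilbert $A$-module $J$ (with the inner product of $A$) such that $b(x) = x$ for all $x \in I$. Here an endomorphism is compact if it is a norm limit of finite sums of rank-one operators $\theta_{x,y}$, $\theta_{x,y}(z) = x\langle y, z\rangle$, with $x, y \in J$. Let $I_1 \otimes I_2$ denote the tensor product of the two ideals, regarded as the closed ideal of the (spatial) C*-tensor product $C(K) \otimes C(K)$ that is the closed linear span of the $f \otimes g$ with $f \in I_1$, $g \in I_2$, and similarly for $J_1 \otimes J_2$. If $I_1 \subset\subset J_1$ and $I_2 \subset\subset J_2$, then $I_1 \otimes I_2 \subset\subset J_1 \otimes J_2$. Moreover, if $I_1$ and $I_2$ are countably generated as Hilbert $C(K)$-modules, then $I_1 \otimes I_2$ is countably generated as a Hilbert $C(K)\otimes C(K)$-module, and likewise for $J_1, J_2$ and $J_1 \otimes J_2$; so the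 conclusion also holds when compact containment is understood only between countably generated Hilbert modules. -/

import Mathlib

open scoped ComplexOrder TensorProduct InnerProductSpace

noncomputable section

/-! ### Hilbert C⋆-modules

`CStarModule A E` is Mathlib's class of (pre-)Hilbert modules `E` over `A`, with `A` acting on the
left and an `A`-valued inner product `⟪x, y⟫_A` that is `A`-linear in `y`; together with
`CompleteSpace E` it is the notion of a Hilbert C⋆-module. -/

namespace HilbertModule

variable (A : Type*) {E : Type*} [CStarAlgebra A] [PartialOrder A] [StarOrderedRing A]
  [NormedAddCommGroup E] [NormedSpace ℂ E] [Module A E] [CStarModule A E] [CompleteSpace E]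

/-- A bounded operator on `E` has finite rank if it is a finite sum of the operators
`θ_{x,y} : z ↦ ⟪y, z⟫ x`. -/
def IsFiniteRank (b : E →L[ℂ] E) : Prop :=
  ∃ (n : ℕ) (x y : Fin n → E), ∀ z : E, b z = ∑ i, ⟪y i, z⟫_A • x i

/-- The compact endomorphisms of `E`: the norm closure of the finite rank ones. -/
def IsCompactEndomorphism (b : E →L[ℂ] E) : Prop :=
  b ∈ closure {c : E →L[ℂ] E | IsFiniteRank A c}

/-- `b` is its own adjoint for the `A`-valued inner product. -/
def IsSelfAdjointEndomorphism (b : E →L[ℂ] E) : Prop :=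
  ∀ x y : E, ⟪b x, y⟫_A = ⟪x, b y⟫_A

variable {A} in
/-- A submodule `X` of a Hilbert module `E` is compactly contained in `E` if some compact
self-adjoint endomorphism of `E` acts as the identity on `X`. -/
def CompactlyContained (X : Submodule A E) : Prop :=
  ∃ b : E →L[ℂ] E, IsCompactEndomorphism A b ∧ IsSelfAdjointEndomorphism A b ∧ ∀ x ∈ X, b x = x

variable (E) in
/-- `E` is the closed submodule generated by some countable subset. -/
def IsCountablyGenerated : Prop :=
  ∃ S : Set E, S.Countable ∧ Dense (Submodule.span A S : Set E)

end HilbertModule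

/-! ### Closed two-sided ideals -/

/-- The closed two-sided ideals of a C⋆-algebra. -/
structure ClosedIdeal (A : Type*) [CStarAlgebra A] where
  toIdeal : Ideal A
  isTwoSided : toIdeal.IsTwoSided
  isClosed : IsClosed (toIdeal : Set A)

namespace ClosedIdeal

section

variable {A : Type*} [CStarAlgebra A]

instance (J : ClosedIdeal A) : CompleteSpace J.toIdeal :=
  J.isClosed.completeSpace_coe

variable [PartialOrder A] [StarOrderedRing A]

/-- An ideal of `A` is a Hilbert module over `A`, with the inner product of `A`
(`⟪x, y⟫ = y x⋆`). -/
instance (J : ClosedIdeal A) : CStarModule A J.toIdeal where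
  inner x y := ⟪(x : A), (y : A)⟫_A
  inner_add_right := by intros; exact CStarModule.inner_add_right
  inner_self_nonneg := CStarModule.inner_self_nonneg
  inner_self := CStarModule.inner_self.trans (by simp)
  inner_op_smul_right := by intros; exact CStarModule.inner_op_smul_right
  inner_smul_right_complex := by intros; exact CStarModule.inner_smul_right_complex
  star_inner _ _ := CStarModule.star_inner _ _
  norm_eq_sqrt_norm_inner_self x := CStarModule.norm_eq_sqrt_norm_inner_self (A := A) (x : A)

/-- `I ⊂⊂ J`: the ideal `I` is contained in `J`, and the Hilbert module `I` is compactly contained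
in the Hilbert module `J`. -/
def CompactlyContained (I J : ClosedIdeal A) : Prop :=
  I.toIdeal ≤ J.toIdeal ∧
    HilbertModule.CompactlyContained (A := A) (E := J.toIdeal)
      (Submodule.comap J.toIdeal.subtype I.toIdeal)

/-- The Hilbert module `I` is countably generated. -/
def IsCountablyGenerated (I : ClosedIdeal A) : Prop :=
  HilbertModule.IsCountablyGenerated A I.toIdeal

end

end ClosedIdeal

infix:50 " ⊂⊂ " => ClosedIdeal.CompactlyContained

/-! ### The spatial tensor product -/

section Spatial

open UniformSpace (Completion)

/-- The Hilbert space tensor product of `H₁` and `H₂`: the completion of their algebraic tensor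
product for the inner product `⟪x ⊗ y, x' ⊗ y'⟫ = ⟪x, x'⟫ ⟪y, y'⟫`. -/
def HilbertTensor (H₁ H₂ : Type*) [NormedAddCommGroup H₁] [InnerProductSpace ℂ H₁]
    [NormedAddCommGroup H₂] [InnerProductSpace ℂ H₂] : Type _ :=
  Completion (H₁ ⊗[ℂ] H₂)

variable {H₁ H₂ : Type*} [NormedAddCommGroup H₁] [InnerProductSpace ℂ H₁]
  [NormedAddCommGroup H₂] [InnerProductSpace ℂ H₂]

instance : NormedAddCommGroup (HilbertTensor H₁ H₂) :=
  inferInstanceAs (NormedAddCommGroup (Completion (H₁ ⊗[ℂ] H₂)))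

instance : InnerProductSpace ℂ (HilbertTensor H₁ H₂) :=
  inferInstanceAs (InnerProductSpace ℂ (Completion (H₁ ⊗[ℂ] H₂)))

instance : CompleteSpace (HilbertTensor H₁ H₂) :=
  inferInstanceAs (CompleteSpace (Completion (H₁ ⊗[ℂ] H₂)))

/-- The inclusion of the algebraic tensor product. -/
def HilbertTensor.of (x : H₁ ⊗[ℂ] H₂) : HilbertTensor H₁ H₂ :=
  (x : Completion (H₁ ⊗[ℂ] H₂))

lemma HilbertTensor.inner_of (x y : H₁ ⊗[ℂ] H₂) :
    ⟪HilbertTensor.of x, HilbertTensor.of y⟫_ℂ = ⟪x, y⟫_ℂ :=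
  Completion.inner_coe x y

lemma HilbertTensor.denseRange_of :
    DenseRange (HilbertTensor.of : H₁ ⊗[ℂ] H₂ → HilbertTensor H₁ H₂) :=
  Completion.denseRange_coe

/-- The operator `S ⊗ T` on the Hilbert space tensor product of `H₁` and `H₂`: the extension by
continuity of `x ⊗ y ↦ S x ⊗ T y`. -/
def opTensor (S : H₁ →L[ℂ] H₁) (T : H₂ →L[ℂ] H₂) :
    HilbertTensor H₁ H₂ →L[ℂ] HilbertTensor H₁ H₂ :=
  (TensorProduct.mapL S T).completion

lemma opTensor_of (S : H₁ →L[ℂ] H₁) (T : H₂ →L[ℂ] H₂) (x : H₁ ⊗[ℂ] H₂) :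
    opTensor S T (HilbertTensor.of x) = HilbertTensor.of (TensorProduct.mapL S T x) :=
  ContinuousLinearMap.completion_apply_coe _ _

lemma opTensor_mul (S S' : H₁ →L[ℂ] H₁) (T T' : H₂ →L[ℂ] H₂) :
    opTensor S T * opTensor S' T' = opTensor (S * S') (T * T') := by
  ext x
  induction x using HilbertTensor.denseRange_of.induction_on with
  | hp => exact isClosed_eq (by fun_prop) (by fun_prop)
  | ih x =>
    rw [mul_apply_eq_comp]
    simp only [opTensor_of, TensorProduct.mapL_mul]
    rfl

variable [CompleteSpace H₁] [CompleteSpace H₂]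

lemma star_opTensor (S : H₁ →L[ℂ] H₁) (T : H₂ →L[ℂ] H₂) :
    star (opTensor S T) = opTensor (star S) (star T) := by
  symm
  refine (ContinuousLinearMap.eq_adjoint_iff _ _).2 fun x y => ?_
  induction x, y using HilbertTensor.denseRange_of.induction_on₂ with
  | hp => exact isClosed_eq (by fun_prop) (by fun_prop)
  | h x y =>
    simp only [opTensor_of, HilbertTensor.inner_of]
    induction x with
    | zero => simp
    | add x x' hx hx' => simp only [map_add, inner_add_left, hx, hx']
    | tmul a b =>
      induction y with
      | zero => simp
      | add y y' hy hy' => simp only [map_add, inner_add_right, hy, hy']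
      | tmul c d =>
        simp [ContinuousLinearMap.star_eq_adjoint, ContinuousLinearMap.adjoint_inner_left]

variable {A B : Type*} [CStarAlgebra A] [CStarAlgebra B]

/-- The C⋆-algebra of operators on the Hilbert space tensor product of `H₁` and `H₂` generated by
all `π a ⊗ ρ b`. -/
def spatialSubalgebra (π : A →⋆ₐ[ℂ] (H₁ →L[ℂ] H₁)) (ρ : B →⋆ₐ[ℂ] (H₂ →L[ℂ] H₂)) :
    StarSubalgebra ℂ (HilbertTensor H₁ H₂ →L[ℂ] HilbertTensor H₁ H₂) :=
  (StarAlgebra.adjoin ℂ {t | ∃ a b, t = opTensor (π a) (ρ b)}).topologicalClosure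

/-- The spatial (minimal) tensor product of the C⋆-algebras `A` and `B`, realized through
representations `π` of `A` and `ρ` of `B`; it is the spatial tensor product of `A` and `B` when
`π` and `ρ` are faithful. -/
def SpatialTensor (π : A →⋆ₐ[ℂ] (H₁ →L[ℂ] H₁)) (ρ : B →⋆ₐ[ℂ] (H₂ →L[ℂ] H₂)) : Type _ :=
  spatialSubalgebra π ρ

namespace SpatialTensor

variable (π : A →⋆ₐ[ℂ] (H₁ →L[ℂ] H₁)) (ρ : B →⋆ₐ[ℂ] (H₂ →L[ℂ] H₂))

instance : IsClosed (spatialSubalgebra π ρ : Set (HilbertTensor H₁ H₂ →L[ℂ] HilbertTensor H₁ H₂)) :=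
  StarSubalgebra.isClosed_topologicalClosure _

instance : CStarAlgebra (SpatialTensor π ρ) :=
  inferInstanceAs (CStarAlgebra (spatialSubalgebra π ρ))

/-- The usual order of a C⋆-algebra: `x ≤ y` if `y - x` is self-adjoint with spectrum in
`[0, ∞)`. -/
instance : PartialOrder (SpatialTensor π ρ) := CStarAlgebra.spectralOrder _

instance : StarOrderedRing (SpatialTensor π ρ) := CStarAlgebra.spectralOrderedRing _

/-- The elementary tensor `a ⊗ b`. -/
def tmul (a : A) (b : B) : SpatialTensor π ρ :=
  ⟨opTensor (π a) (ρ b), StarSubalgebra.le_topologicalClosure _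
    (StarAlgebra.subset_adjoin ℂ _ ⟨a, b, rfl⟩)⟩

lemma tmul_mul (a a' : A) (b b' : B) :
    tmul π ρ a b * tmul π ρ a' b' = tmul π ρ (a * a') (b * b') :=
  Subtype.ext ((opTensor_mul _ _ _ _).trans (by simp [tmul]))

lemma star_tmul (a : A) (b : B) : star (tmul π ρ a b) = tmul π ρ (star a) (star b) :=
  Subtype.ext ((star_opTensor _ _).trans (by rw [← map_star π, ← map_star ρ]; rfl))

/-- A closed set which is stable under the algebra operations and contains the elementary tensors
is everything. -/
lemma induction {P : SpatialTensor π ρ → Prop} (hP : IsClosed {t | P t})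
    (tm : ∀ a b, P (tmul π ρ a b)) (alg : ∀ c : ℂ, P (algebraMap ℂ _ c))
    (add : ∀ x y, P x → P y → P (x + y)) (mul : ∀ x y, P x → P y → P (x * y))
    (t : SpatialTensor π ρ) : P t := by
  let S : Set (spatialSubalgebra π ρ) :=
    {u | u.1 ∈ StarAlgebra.adjoin ℂ {t | ∃ a b, t = opTensor (π a) (ρ b)}}
  have hle : StarAlgebra.adjoin ℂ {t | ∃ a b, t = opTensor (π a) (ρ b)} ≤ spatialSubalgebra π ρ :=
    StarSubalgebra.le_topologicalClosure _
  have ht : (show spatialSubalgebra π ρ from t) ∈ closure S := by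
    rw [closure_subtype]
    have : Subtype.val '' S =
        (StarAlgebra.adjoin ℂ {t | ∃ a b, t = opTensor (π a) (ρ b)} : Set _) := by
      ext x
      exact ⟨fun ⟨u, hu, h⟩ => h ▸ hu, fun hx => ⟨⟨x, hle hx⟩, hx, rfl⟩⟩
    rw [this]
    exact t.2
  have hS : ∀ x (hx : x ∈ StarAlgebra.adjoin ℂ {t | ∃ a b, t = opTensor (π a) (ρ b)}),
      P ⟨x, hle hx⟩ := by
    intro x hx
    have hx' : x ∈ Algebra.adjoin ℂ {t | ∃ a b, t = opTensor (π a) (ρ b)} := by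
      rw [← StarSubalgebra.mem_toSubalgebra, StarAlgebra.adjoin_toSubalgebra] at hx
      refine Algebra.adjoin_mono (Set.union_subset subset_rfl ?_) hx
      rintro y ⟨a, b, h⟩
      refine ⟨star a, star b, ?_⟩
      rw [map_star π, map_star ρ, ← star_opTensor, ← h, star_star]
    have hle' : Algebra.adjoin ℂ {t | ∃ a b, t = opTensor (π a) (ρ b)} ≤
        (spatialSubalgebra π ρ).toSubalgebra :=
      Algebra.adjoin_le fun y hy => hle (StarAlgebra.subset_adjoin ℂ _ hy)
    suffices h : P ⟨x, hle' hx'⟩ from h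
    clear hx
    induction hx' using Algebra.adjoin_induction with
    | mem x hx => obtain ⟨a, b, rfl⟩ := hx; exact tm a b
    | algebraMap c => exact alg c
    | add x y hx hy h h' => exact add ⟨x, hle' hx⟩ ⟨y, hle' hy⟩ h h'
    | mul x y hx hy h h' => exact mul ⟨x, hle' hx⟩ ⟨y, hle' hy⟩ h h'
  exact closure_minimal (s := S) (t := {t | P t}) (fun u hu => hS u.1 hu) hP ht

end SpatialTensor

namespace ClosedIdeal

variable (π : A →⋆ₐ[ℂ] (H₁ →L[ℂ] H₁)) (ρ : B →⋆ₐ[ℂ] (H₂ →L[ℂ] H₂))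

/-- The closed linear span of the `a ⊗ b` with `a ∈ I` and `b ∈ J`. -/
def tensorSpan (I : ClosedIdeal A) (J : ClosedIdeal B) : Submodule ℂ (SpatialTensor π ρ) :=
  (Submodule.span ℂ {t | ∃ a ∈ I.toIdeal, ∃ b ∈ J.toIdeal,
    t = SpatialTensor.tmul π ρ a b}).topologicalClosure

lemma tensorSpan_induction (I : ClosedIdeal A) (J : ClosedIdeal B)
    (f : SpatialTensor π ρ →L[ℂ] SpatialTensor π ρ)
    (hf : ∀ a ∈ I.toIdeal, ∀ b ∈ J.toIdeal, f (SpatialTensor.tmul π ρ a b) ∈ tensorSpan π ρ I J) :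
    ∀ x ∈ tensorSpan π ρ I J, f x ∈ tensorSpan π ρ I J := by
  have : tensorSpan π ρ I J ≤ (tensorSpan π ρ I J).comap (f : _ →ₗ[ℂ] _) := by
    refine Submodule.topologicalClosure_minimal _ (Submodule.span_le.2 ?_) ?_
    · rintro _ ⟨a, ha, b, hb, rfl⟩
      exact hf a ha b hb
    · exact (Submodule.isClosed_topologicalClosure _).preimage f.continuous
  exact fun x hx => this hx

lemma tmul_mem_tensorSpan {I : ClosedIdeal A} {J : ClosedIdeal B} {a : A} {b : B}
    (ha : a ∈ I.toIdeal) (hb : b ∈ J.toIdeal) :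
    SpatialTensor.tmul π ρ a b ∈ tensorSpan π ρ I J :=
  Submodule.le_topologicalClosure _ (Submodule.subset_span ⟨a, ha, b, hb, rfl⟩)

lemma mul_mem_tensorSpan (I : ClosedIdeal A) (J : ClosedIdeal B) (t : SpatialTensor π ρ) :
    ∀ x ∈ tensorSpan π ρ I J, t * x ∈ tensorSpan π ρ I J ∧ x * t ∈ tensorSpan π ρ I J := by
  have := I.isTwoSided
  have := J.isTwoSided
  have hcl : IsClosed (tensorSpan π ρ I J : Set (SpatialTensor π ρ)) :=
    Submodule.isClosed_topologicalClosure _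
  induction t using SpatialTensor.induction with
  | hP =>
    simp only [Set.ofPred_forall, Set.ofPred_and]
    exact isClosed_iInter fun x => isClosed_iInter fun _ =>
      (hcl.preimage (continuous_mul_const x)).inter (hcl.preimage (continuous_const_mul x))
  | tm a b =>
    intro x hx
    refine ⟨tensorSpan_induction π ρ I J (ContinuousLinearMap.mul ℂ _ (.tmul π ρ a b)) ?_ x hx,
      tensorSpan_induction π ρ I J ((ContinuousLinearMap.mul ℂ _).flip (.tmul π ρ a b)) ?_ x hx⟩
    · intro a' ha' b' hb'
      rw [ContinuousLinearMap.mul_apply', SpatialTensor.tmul_mul]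
      exact tmul_mem_tensorSpan π ρ
        (I.toIdeal.mul_mem_left a ha') (J.toIdeal.mul_mem_left b hb')
    · intro a' ha' b' hb'
      rw [ContinuousLinearMap.flip_apply, ContinuousLinearMap.mul_apply', SpatialTensor.tmul_mul]
      exact tmul_mem_tensorSpan π ρ
        (I.toIdeal.mul_mem_right a ha') (J.toIdeal.mul_mem_right b hb')
  | alg c =>
    intro x hx
    rw [← Algebra.commutes, ← Algebra.smul_def]
    exact ⟨Submodule.smul_mem _ _ hx, Submodule.smul_mem _ _ hx⟩
  | add t u ht hu =>
    intro x hx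
    rw [add_mul, mul_add]
    exact ⟨add_mem (ht x hx).1 (hu x hx).1, add_mem (ht x hx).2 (hu x hx).2⟩
  | mul t u ht hu =>
    intro x hx
    rw [mul_assoc, ← mul_assoc x]
    exact ⟨(ht _ (hu x hx).1).1, (hu _ (ht x hx).2).2⟩

/-- The tensor product `I ⊗ J` of closed ideals `I` of `A` and `J` of `B`, as a closed ideal of the
spatial tensor product of `A` and `B`: the closed linear span of the `a ⊗ b` with `a ∈ I` and
`b ∈ J`. -/
def tensor (I : ClosedIdeal A) (J : ClosedIdeal B) : ClosedIdeal (SpatialTensor π ρ) where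
  toIdeal :=
    { carrier := tensorSpan π ρ I J
      add_mem' := add_mem
      zero_mem' := zero_mem _
      smul_mem' := fun t x hx => (mul_mem_tensorSpan π ρ I J t x hx).1 }
  isTwoSided := ⟨fun t hx => (mul_mem_tensorSpan π ρ I J t _ hx).2⟩
  isClosed := Submodule.isClosed_topologicalClosure _

end ClosedIdeal
end Spatial
end

/-! For ideals of `C(K)`, `I ⊂⊂ J` amounts to the existence of `h ∈ J` with `h⋆ h` acting as a unit
on `I`. Given such an `h`, the rank one operator `θ_{h,h}` witnesses compact containment
(`compactlyContained_of_mul_eq`, valid over any C⋆-algebra). Conversely, a finite rank operator is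
multiplication by some `k ∈ J`; if it is close to an operator fixing `I`, then `|k|` is bounded
below wherever some element of `I` is nonzero, and normalising `k` gives `h`
(`exists_mul_eq_of_compactlyContained`). The criterion passes to tensor products: if `g`, `h` serve
the two factors, `g ⊗ h` lies in `J₁ ⊗ J₂` and `(g ⊗ h)⋆ (g ⊗ h) = g⋆ g ⊗ h⋆ h` fixes elementary
tensors, hence all of `I₁ ⊗ I₂`. Countable generation follows by tensoring generators, since `⊗` is
continuous in each variable. -/

namespace ClosedIdeal

/-! ### Rank one endomorphisms of a closed ideal -/

section

variable {A : Type*} [CStarAlgebra A] [PartialOrder A] [StarOrderedRing A]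

/-- The rank one endomorphism `z ↦ ⟪h, z⟫ h = z h⋆ h` of a closed ideal. -/
noncomputable def rankOne (J : ClosedIdeal A) (h : J.toIdeal) : J.toIdeal →L[ℂ] J.toIdeal :=
  LinearMap.mkContinuous
    { toFun := fun z => ⟪h, z⟫_A • h
      map_add' := fun _ _ => by rw [CStarModule.inner_add_right, add_smul]
      map_smul' := fun _ _ => by
        rw [CStarModule.inner_smul_right_complex, smul_assoc, RingHom.id_apply] }
    (‖(h : A)‖ * ‖(h : A)‖) fun z => by
      change ‖(z : A) * star (h : A) * (h : A)‖ ≤ _ * ‖(z : A)‖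
      refine (norm_mul_le _ _).trans ?_
      refine (mul_le_mul_of_nonneg_right (norm_mul_le _ _) (norm_nonneg _)).trans ?_
      rw [norm_star]
      exact (by ring : ‖(z : A)‖ * ‖(h : A)‖ * ‖(h : A)‖ = ‖(h : A)‖ * ‖(h : A)‖ * ‖(z : A)‖).le

lemma coe_rankOne (J : ClosedIdeal A) (h z : J.toIdeal) :
    (J.rankOne h z : A) = z * (star (h : A) * h) :=
  mul_assoc (z : A) _ _

lemma isFiniteRank_rankOne (J : ClosedIdeal A) (h : J.toIdeal) :
    HilbertModule.IsFiniteRank A (J.rankOne h) :=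
  ⟨1, fun _ => h, fun _ => h, fun _ => by rw [Fin.sum_univ_one]; rfl⟩

lemma isSelfAdjointEndomorphism_rankOne (J : ClosedIdeal A) (h : J.toIdeal) :
    HilbertModule.IsSelfAdjointEndomorphism A (J.rankOne h) := fun x y => by
  change (y : A) * star (J.rankOne h x : A) = (J.rankOne h y : A) * star (x : A)
  simp only [coe_rankOne, star_mul, star_star, mul_assoc]

/-- If `h ∈ J` is such that `h⋆ h` acts as a unit on `I ⊆ J`, then `I ⊂⊂ J`. -/
lemma compactlyContained_of_mul_eq {I J : ClosedIdeal A} (hIJ : I.toIdeal ≤ J.toIdeal) {h : A}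
    (hJ : h ∈ J.toIdeal) (hI : ∀ x ∈ I.toIdeal, x * (star h * h) = x) : I ⊂⊂ J :=
  ⟨hIJ, J.rankOne ⟨h, hJ⟩, subset_closure (J.isFiniteRank_rankOne _),
    J.isSelfAdjointEndomorphism_rankOne _, fun x hx => Subtype.ext <|
      (J.coe_rankOne ⟨h, hJ⟩ x).trans (hI x hx)⟩

end

section

variable {A : Type*} [CommCStarAlgebra A] [PartialOrder A] [StarOrderedRing A]

/-- Over a commutative C⋆-algebra the finite rank endomorphisms of an ideal are multiplications by
elements of the ideal. -/
lemma exists_mul_of_isFiniteRank {J : ClosedIdeal A} {c : J.toIdeal →L[ℂ] J.toIdeal}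
    (hc : HilbertModule.IsFiniteRank A c) :
    ∃ k ∈ J.toIdeal, ∀ z, (c z : A) = z * k := by
  obtain ⟨n, x, y, h⟩ := hc
  refine ⟨∑ i, star (y i : A) * x i,
    sum_mem fun i _ => J.toIdeal.mul_mem_left _ (x i).2, fun z => ?_⟩
  rw [h, AddSubmonoidClass.coe_finsetSum, Finset.mul_sum]
  exact Finset.sum_congr rfl fun i _ => mul_assoc (z : A) _ _

end

/-! ### Compact containment in `C(K)` -/

section

variable {K : Type*} [TopologicalSpace K]

/-- For `f : C(K, ℂ)` and `δ > 0`, the function `1 / max(|f|, δ)`. -/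
noncomputable def invMaxNorm (f : C(K, ℂ)) (δ : ℝ) (hδ : 0 < δ) : C(K, ℂ) where
  toFun t := ((max ‖f t‖ δ)⁻¹ : ℝ)
  continuous_toFun := Complex.continuous_ofReal.comp <|
    (f.continuous.norm.max continuous_const).inv₀ fun _ => (lt_max_of_lt_right hδ).ne'

lemma norm_mul_invMaxNorm (f : C(K, ℂ)) {δ : ℝ} (hδ : 0 < δ) (t : K) :
    ‖(f * invMaxNorm f δ hδ) t‖ = ‖f t‖ * (max ‖f t‖ δ)⁻¹ := by
  have : 0 ≤ (max ‖f t‖ δ)⁻¹ := inv_nonneg.2 (hδ.le.trans (le_max_right _ _))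
  rw [ContinuousMap.mul_apply, norm_mul]
  congr 1
  exact (Complex.norm_real _).trans (Real.norm_of_nonneg this)

lemma norm_mul_invMaxNorm_eq_one (f : C(K, ℂ)) {δ : ℝ} (hδ : 0 < δ) {t : K} (ht : δ ≤ ‖f t‖) :
    ‖(f * invMaxNorm f δ hδ) t‖ = 1 := by
  rw [norm_mul_invMaxNorm, max_eq_left ht, mul_inv_cancel₀ (hδ.trans_le ht).ne']

variable [CompactSpace K]

lemma norm_mul_invMaxNorm_le_one (f : C(K, ℂ)) {δ : ℝ} (hδ : 0 < δ) :
    ‖f * invMaxNorm f δ hδ‖ ≤ 1 :=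
  (ContinuousMap.norm_le _ zero_le_one).2 fun t => by
    rw [norm_mul_invMaxNorm, ← div_eq_mul_inv]
    exact div_le_one_of_le₀ (le_max_left _ _) (hδ.le.trans (le_max_right _ _))

/-- Compact containment `I ⊂⊂ J` of ideals of `C(K)` provides `h ∈ J` with `|h| = 1` wherever some
element of `I` does not vanish. -/
lemma exists_mul_eq_of_compactlyContained {I J : ClosedIdeal C(K, ℂ)} (hIJ : I ⊂⊂ J) :
    ∃ h ∈ J.toIdeal, ∀ x ∈ I.toIdeal, x * (star h * h) = x := by
  obtain ⟨hle, b, hb, -, hbI⟩ := hIJ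
  -- Any error `ε < 1` would do: it yields `|k| ≥ 1 - ε` on the support in question, here `1 / 2`.
  obtain ⟨c, hc, hbc⟩ := Metric.mem_closure_iff.1 hb (1 / 2) one_half_pos
  obtain ⟨k, hk, hck⟩ := exists_mul_of_isFiniteRank hc
  rw [dist_eq_norm] at hbc
  have hclose : ∀ x ∈ I.toIdeal, ‖x - x * k‖ ≤ 1 / 2 * ‖x‖ := fun x hx => by
    have h := (b - c).le_of_opNorm_le hbc.le ⟨x, hle hx⟩
    rw [sub_apply, hbI ⟨x, hle hx⟩ hx] at h
    rw [← hck ⟨x, hle hx⟩]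
    exact h
  have hlower : ∀ x ∈ I.toIdeal, ∀ t, x t ≠ 0 → 1 / 2 ≤ ‖k t‖ := fun x hx t ht => by
    -- The norm bound `hclose` becomes a bound at `t` by replacing `x` with `u = x / max(|x|, |x
    -- t|)`, which is still in `I`, has norm at most `1` and has modulus `1` at `t`.
    have hδ : 0 < ‖x t‖ := norm_pos_iff.2 ht
    have h1 := norm_mul_invMaxNorm_eq_one x hδ le_rfl
    have h2 := norm_mul_invMaxNorm_le_one x hδ
    have h3 := hclose _ (I.toIdeal.mul_mem_right (invMaxNorm x _ hδ) hx)
    set u := x * invMaxNorm x ‖x t‖ hδ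
    have h4 : ‖u t - u t * k t‖ ≤ 1 / 2 :=
      ((u - u * k).norm_coe_le_norm t).trans (h3.trans (by linarith))
    have h5 := norm_sub_norm_le (u t) (u t * k t)
    rw [norm_mul, h1] at h5
    linarith
  -- Dividing by `max(|k|, 1/2)` rather than `|k|` keeps the quotient continuous at zeros of `k`,
  -- and still gives modulus `1` wherever `hlower` applies.
  refine ⟨k * invMaxNorm k (1 / 2) one_half_pos, J.toIdeal.mul_mem_right _ hk, fun x hx => ?_⟩
  ext t
  by_cases ht : x t = 0
  · simp [ht]
  · have h := norm_mul_invMaxNorm_eq_one k one_half_pos (hlower x hx t ht)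
    set u := k * invMaxNorm k (1 / 2) one_half_pos
    rw [ContinuousMap.mul_apply, ContinuousMap.mul_apply, ContinuousMap.star_apply,
      RCLike.star_def, RCLike.conj_mul, h]
    simp

end

end ClosedIdeal

/-! ### The amplifications `S ⊗ 1` and `1 ⊗ T` as representations -/

section Spatial

variable {H₁ H₂ : Type*} [NormedAddCommGroup H₁] [InnerProductSpace ℂ H₁]
  [NormedAddCommGroup H₂] [InnerProductSpace ℂ H₂]

lemma opTensor_add_left (S S' : H₁ →L[ℂ] H₁) (T : H₂ →L[ℂ] H₂) :
    opTensor (S + S') T = opTensor S T + opTensor S' T := by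
  ext x
  induction x using HilbertTensor.denseRange_of.induction_on with
  | hp => exact isClosed_eq (by fun_prop) (by fun_prop)
  | ih x =>
    rw [add_apply]
    simp only [opTensor_of]
    refine Eq.trans ?_ (UniformSpace.Completion.coe_add _ _)
    refine congrArg HilbertTensor.of ?_
    induction x with
    | zero => simp
    | add x y hx hy => rw [map_add, hx, hy, map_add, map_add]; abel
    | tmul a b => exact TensorProduct.add_tmul _ _ _

lemma opTensor_add_right (S : H₁ →L[ℂ] H₁) (T T' : H₂ →L[ℂ] H₂) :
    opTensor S (T + T') = opTensor S T + opTensor S T' := by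
  ext x
  induction x using HilbertTensor.denseRange_of.induction_on with
  | hp => exact isClosed_eq (by fun_prop) (by fun_prop)
  | ih x =>
    rw [add_apply]
    simp only [opTensor_of]
    refine Eq.trans ?_ (UniformSpace.Completion.coe_add _ _)
    refine congrArg HilbertTensor.of ?_
    induction x with
    | zero => simp
    | add x y hx hy => rw [map_add, hx, hy, map_add, map_add]; abel
    | tmul a b => exact TensorProduct.tmul_add _ _ _

lemma opTensor_algebraMap_left (c : ℂ) :
    opTensor (algebraMap ℂ (H₁ →L[ℂ] H₁) c) (1 : H₂ →L[ℂ] H₂) = algebraMap ℂ _ c := by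
  ext x
  induction x using HilbertTensor.denseRange_of.induction_on with
  | hp => exact isClosed_eq (by fun_prop) (by fun_prop)
  | ih x =>
    rw [opTensor_of, Algebra.algebraMap_eq_smul_one (A := HilbertTensor H₁ H₂ →L[ℂ] _)]
    refine Eq.trans ?_ (UniformSpace.Completion.coe_smul c x)
    refine congrArg HilbertTensor.of ?_
    induction x with
    | zero => simp
    | add x y hx hy => rw [map_add, hx, hy, smul_add]
    | tmul a b => rfl

lemma opTensor_algebraMap_right (c : ℂ) :
    opTensor (1 : H₁ →L[ℂ] H₁) (algebraMap ℂ (H₂ →L[ℂ] H₂) c) = algebraMap ℂ _ c := by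
  ext x
  induction x using HilbertTensor.denseRange_of.induction_on with
  | hp => exact isClosed_eq (by fun_prop) (by fun_prop)
  | ih x =>
    rw [opTensor_of, Algebra.algebraMap_eq_smul_one (A := HilbertTensor H₁ H₂ →L[ℂ] _)]
    refine Eq.trans ?_ (UniformSpace.Completion.coe_smul c x)
    refine congrArg HilbertTensor.of ?_
    induction x with
    | zero => simp
    | add x y hx hy => rw [map_add, hx, hy, smul_add]
    | tmul a b => exact TensorProduct.tmul_smul _ _ _

variable [CompleteSpace H₁] [CompleteSpace H₂]

/-- The representation `S ↦ S ⊗ 1`. -/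
noncomputable def opTensorLeft : (H₁ →L[ℂ] H₁) →⋆ₐ[ℂ] (HilbertTensor H₁ H₂ →L[ℂ] HilbertTensor H₁ H₂) where
  toFun S := opTensor S 1
  map_one' := by rw [← map_one (algebraMap ℂ (H₁ →L[ℂ] H₁)), opTensor_algebraMap_left, map_one]
  map_mul' S S' := by rw [opTensor_mul, one_mul]
  map_zero' := by
    rw [← map_zero (algebraMap ℂ (H₁ →L[ℂ] H₁)), opTensor_algebraMap_left, map_zero]
  map_add' S S' := opTensor_add_left S S' 1
  commutes' := opTensor_algebraMap_left
  map_star' S := by rw [star_opTensor, star_one]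

/-- The representation `T ↦ 1 ⊗ T`. -/
noncomputable def opTensorRight : (H₂ →L[ℂ] H₂) →⋆ₐ[ℂ] (HilbertTensor H₁ H₂ →L[ℂ] HilbertTensor H₁ H₂) where
  toFun T := opTensor 1 T
  map_one' := by rw [← map_one (algebraMap ℂ (H₂ →L[ℂ] H₂)), opTensor_algebraMap_right, map_one]
  map_mul' T T' := by rw [opTensor_mul, one_mul]
  map_zero' := by
    rw [← map_zero (algebraMap ℂ (H₂ →L[ℂ] H₂)), opTensor_algebraMap_right, map_zero]
  map_add' T T' := opTensor_add_right 1 T T'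
  commutes' := opTensor_algebraMap_right
  map_star' T := by rw [star_opTensor, star_one]

variable {A B : Type*} [CStarAlgebra A] [CStarAlgebra B]
variable (π : A →⋆ₐ[ℂ] (H₁ →L[ℂ] H₁)) (ρ : B →⋆ₐ[ℂ] (H₂ →L[ℂ] H₂))

/-! ### Continuity and additivity of elementary tensors -/

namespace SpatialTensor

/-- `a ↦ π a ⊗ 1` is a ⋆-homomorphism of C⋆-algebras, hence automatically contractive; no estimate
of the norm of `S ⊗ T` is needed. -/
lemma continuous_tmul_one : Continuous fun a => tmul π ρ a 1 := by
  have h : Continuous ((opTensorLeft (H₂ := H₂)).comp π) :=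
    AddMonoidHomClass.continuous_of_bound _ 1 fun a => by
      rw [one_mul]; exact NonUnitalStarAlgHom.norm_apply_le _ a
  refine Continuous.subtype_mk (h.congr fun a => ?_) _
  rw [map_one]
  rfl

lemma continuous_one_tmul : Continuous fun b => tmul π ρ 1 b := by
  have h : Continuous ((opTensorRight (H₁ := H₁)).comp ρ) :=
    AddMonoidHomClass.continuous_of_bound _ 1 fun a => by
      rw [one_mul]; exact NonUnitalStarAlgHom.norm_apply_le _ a
  refine Continuous.subtype_mk (h.congr fun a => ?_) _
  rw [map_one]
  rfl

lemma tmul_one_mul_one_tmul (a : A) (b : B) : tmul π ρ a 1 * tmul π ρ 1 b = tmul π ρ a b := by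
  rw [tmul_mul, mul_one, one_mul]

lemma continuous_tmul_left (b : B) : Continuous fun a => tmul π ρ a b :=
  ((continuous_tmul_one π ρ).mul continuous_const).congr fun a => tmul_one_mul_one_tmul π ρ a b

lemma continuous_tmul_right (a : A) : Continuous fun b => tmul π ρ a b :=
  (continuous_const.mul (continuous_one_tmul π ρ)).congr fun b => tmul_one_mul_one_tmul π ρ a b

lemma add_tmul (a a' : A) (b : B) : tmul π ρ (a + a') b = tmul π ρ a b + tmul π ρ a' b :=
  Subtype.ext <| (congrArg (opTensor · (ρ b)) (map_add π a a')).trans (opTensor_add_left _ _ _)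

lemma tmul_add (a : A) (b b' : B) : tmul π ρ a (b + b') = tmul π ρ a b + tmul π ρ a b' :=
  Subtype.ext <| (congrArg (opTensor (π a)) (map_add ρ b b')).trans (opTensor_add_right _ _ _)

lemma zero_tmul (b : B) : tmul π ρ 0 b = 0 := by
  have h := add_tmul π ρ 0 0 b
  rwa [add_zero, right_eq_add] at h

lemma tmul_zero (a : A) : tmul π ρ a 0 = 0 := by
  have h := tmul_add π ρ a 0 0
  rwa [add_zero, right_eq_add] at h

/-- If `a' ⊗ b` lies in a closed left ideal for all `a'` in a set whose span is dense in `I`, then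
so does `a ⊗ b` for all `a ∈ I`. -/
lemma tmul_mem_of_dense_left {I : Ideal A} {S : Set I} (hS : Dense (Submodule.span A S : Set I))
    {N : Ideal (SpatialTensor π ρ)} (hN : IsClosed (N : Set (SpatialTensor π ρ))) {b : B}
    (h : ∀ s ∈ S, tmul π ρ s b ∈ N) {a : A} (ha : a ∈ I) : tmul π ρ a b ∈ N := by
  suffices key : ∀ a ∈ Submodule.span A S, tmul π ρ a b ∈ N by
    have hc : Continuous fun a : I => tmul π ρ a b :=
      (continuous_tmul_left π ρ b).comp continuous_subtype_val
    have ha' := hS ⟨a, ha⟩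
    have hmem := map_mem_closure hc ha' key
    rw [hN.closure_eq] at hmem
    exact hmem
  intro a ha
  induction ha using Submodule.span_induction with
  | mem x hx => exact h x hx
  | zero => rw [ZeroMemClass.coe_zero, zero_tmul]; exact zero_mem _
  | add x y _ _ hx hy => rw [Submodule.coe_add, add_tmul]; exact add_mem hx hy
  | smul c x _ hx =>
    rw [Submodule.coe_smul, smul_eq_mul]
    -- The scalar `c` is absorbed by the left ideal: `(c x) ⊗ b = (c ⊗ 1)(x ⊗ b)`.
    have h := N.mul_mem_left (tmul π ρ c 1) hx
    rwa [tmul_mul, one_mul] at h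

/-- If `a ⊗ b'` lies in a closed left ideal for all `b'` in a set whose span is dense in `J`, then
so does `a ⊗ b` for all `b ∈ J`. -/
lemma tmul_mem_of_dense_right {J : Ideal B} {S : Set J} (hS : Dense (Submodule.span B S : Set J))
    {N : Ideal (SpatialTensor π ρ)} (hN : IsClosed (N : Set (SpatialTensor π ρ))) {a : A}
    (h : ∀ s ∈ S, tmul π ρ a s ∈ N) {b : B} (hb : b ∈ J) : tmul π ρ a b ∈ N := by
  suffices key : ∀ b ∈ Submodule.span B S, tmul π ρ a b ∈ N by
    have hc : Continuous fun b : J => tmul π ρ a b :=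
      (continuous_tmul_right π ρ a).comp continuous_subtype_val
    have hb' := hS ⟨b, hb⟩
    have hmem := map_mem_closure hc hb' key
    rw [hN.closure_eq] at hmem
    exact hmem
  intro b hb
  induction hb using Submodule.span_induction with
  | mem x hx => exact h x hx
  | zero => rw [ZeroMemClass.coe_zero, tmul_zero]; exact zero_mem _
  | add x y _ _ hx hy => rw [Submodule.coe_add, tmul_add]; exact add_mem hx hy
  | smul c x _ hx =>
    rw [Submodule.coe_smul, smul_eq_mul]
    have h := N.mul_mem_left (tmul π ρ 1 c) hx
    rwa [tmul_mul, one_mul] at h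

end SpatialTensor

/-! ### Tensor products of closed ideals -/

namespace ClosedIdeal

lemma tmul_mem_tensor {I : ClosedIdeal A} {J : ClosedIdeal B} {a : A} {b : B}
    (ha : a ∈ I.toIdeal) (hb : b ∈ J.toIdeal) :
    SpatialTensor.tmul π ρ a b ∈ (tensor π ρ I J).toIdeal :=
  tmul_mem_tensorSpan π ρ ha hb

/-- A closed subspace containing the `a ⊗ b` with `a ∈ I` and `b ∈ J` contains `I ⊗ J`. -/
lemma mem_of_mem_tensor {I : ClosedIdeal A} {J : ClosedIdeal B}
    {N : Submodule ℂ (SpatialTensor π ρ)} (hN : IsClosed (N : Set (SpatialTensor π ρ)))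
    (h : ∀ a ∈ I.toIdeal, ∀ b ∈ J.toIdeal, SpatialTensor.tmul π ρ a b ∈ N)
    {x : SpatialTensor π ρ} (hx : x ∈ (tensor π ρ I J).toIdeal) : x ∈ N := by
  refine Submodule.topologicalClosure_minimal _ (Submodule.span_le.2 ?_) hN hx
  rintro _ ⟨a, ha, b, hb, rfl⟩
  exact h a ha b hb

lemma tensor_mono {I I' : ClosedIdeal A} {J J' : ClosedIdeal B} (hI : I.toIdeal ≤ I'.toIdeal)
    (hJ : J.toIdeal ≤ J'.toIdeal) : (tensor π ρ I J).toIdeal ≤ (tensor π ρ I' J').toIdeal :=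
  fun _ hx => mem_of_mem_tensor π ρ (N := tensorSpan π ρ I' J')
    (Submodule.isClosed_topologicalClosure _)
    (fun _ ha _ hb => tmul_mem_tensorSpan π ρ (hI ha) (hJ hb)) hx

/-- If `g⋆ g` acts as a unit on `I` and `h⋆ h` on `J`, then `(g ⊗ h)⋆ (g ⊗ h)` does on `I ⊗ J`. -/
lemma mul_eq_of_mem_tensor {I : ClosedIdeal A} {J : ClosedIdeal B} {g : A} {h : B}
    (hg : ∀ a ∈ I.toIdeal, a * (star g * g) = a) (hh : ∀ b ∈ J.toIdeal, b * (star h * h) = b)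
    {x : SpatialTensor π ρ} (hx : x ∈ (tensor π ρ I J).toIdeal) :
    x * (star (SpatialTensor.tmul π ρ g h) * SpatialTensor.tmul π ρ g h) = x := by
  let f : SpatialTensor π ρ →L[ℂ] SpatialTensor π ρ := (ContinuousLinearMap.mul ℂ _).flip
    (star (SpatialTensor.tmul π ρ g h) * SpatialTensor.tmul π ρ g h)
  -- The fixed points of right multiplication form a closed subspace, so elementary tensors suffice.
  refine mem_of_mem_tensor π ρ (N := LinearMap.eqLocus (f : _ →ₗ[ℂ] _) LinearMap.id)
    (isClosed_eq f.continuous continuous_id) (fun a ha b hb => ?_) hx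
  change SpatialTensor.tmul π ρ a b * _ = _
  rw [SpatialTensor.star_tmul, SpatialTensor.tmul_mul, SpatialTensor.tmul_mul, hg a ha, hh b hb]
  rfl

lemma IsCountablyGenerated.tensor [PartialOrder A] [StarOrderedRing A] [PartialOrder B]
    [StarOrderedRing B] {I : ClosedIdeal A} {J : ClosedIdeal B} (hI : I.IsCountablyGenerated)
    (hJ : J.IsCountablyGenerated) : (tensor π ρ I J).IsCountablyGenerated := by
  obtain ⟨S, hSc, hS⟩ := hI
  obtain ⟨T, hTc, hT⟩ := hJ
  let e : I.toIdeal × J.toIdeal → (ClosedIdeal.tensor π ρ I J).toIdeal :=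
    fun p => ⟨_, tmul_mem_tensor π ρ p.1.2 p.2.2⟩
  refine ⟨e '' S ×ˢ T, (hSc.prod hTc).image _, fun x => ?_⟩
  -- The span is pushed into the ambient algebra, so that density in `I ⊗ J` becomes membership in a
  -- closed left ideal there.
  let M : Submodule (SpatialTensor π ρ) (SpatialTensor π ρ) :=
    (Submodule.span (SpatialTensor π ρ) (e '' S ×ˢ T)).map
      (ClosedIdeal.tensor π ρ I J).toIdeal.subtype
  rw [closure_subtype]
  have hcl : IsClosed (M.topologicalClosure : Set (SpatialTensor π ρ)) :=
    M.isClosed_topologicalClosure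
  refine mem_of_mem_tensor π ρ (N := M.topologicalClosure.restrictScalars ℂ) hcl
    (fun a ha b hb => ?_) x.2
  -- One variable at a time: `a` is reduced to generators with `b` arbitrary in `J`, then `b` with
  -- the generator `s` fixed.
  refine SpatialTensor.tmul_mem_of_dense_left π ρ hS hcl (fun s hs => ?_) ha
  refine SpatialTensor.tmul_mem_of_dense_right π ρ hT hcl (fun t ht => ?_) hb
  exact M.le_topologicalClosure
    ⟨e (s, t), Submodule.subset_span ⟨(s, t), ⟨hs, ht⟩, rfl⟩, rfl⟩

end ClosedIdeal

end Spatial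

theorem mainTheorem3 {K : Type*} [TopologicalSpace K] [CompactSpace K] [T2Space K]
    {H₁ : Type*} [NormedAddCommGroup H₁] [InnerProductSpace ℂ H₁] [CompleteSpace H₁]
    {H₂ : Type*} [NormedAddCommGroup H₂] [InnerProductSpace ℂ H₂] [CompleteSpace H₂]
    (π₁ : C(K, ℂ) →⋆ₐ[ℂ] (H₁ →L[ℂ] H₁)) (hπ₁ : Function.Injective π₁)
    (π₂ : C(K, ℂ) →⋆ₐ[ℂ] (H₂ →L[ℂ] H₂)) (hπ₂ : Function.Injective π₂)
    (I₁ I₂ J₁ J₂ : ClosedIdeal C(K, ℂ)) (h₁ : I₁ ⊂⊂ J₁) (h₂ : I₂ ⊂⊂ J₂) :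
    ClosedIdeal.tensor π₁ π₂ I₁ I₂ ⊂⊂ ClosedIdeal.tensor π₁ π₂ J₁ J₂ ∧
    (I₁.IsCountablyGenerated → I₂.IsCountablyGenerated →
      (ClosedIdeal.tensor π₁ π₂ I₁ I₂).IsCountablyGenerated) ∧
    (J₁.IsCountablyGenerated → J₂.IsCountablyGenerated →
      (ClosedIdeal.tensor π₁ π₂ J₁ J₂).IsCountablyGenerated) := by
  obtain ⟨g, hgJ, hg⟩ := ClosedIdeal.exists_mul_eq_of_compactlyContained h₁
  obtain ⟨h, hhJ, hh⟩ := ClosedIdeal.exists_mul_eq_of_compactlyContained h₂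
  exact ⟨ClosedIdeal.compactlyContained_of_mul_eq (ClosedIdeal.tensor_mono π₁ π₂ h₁.1 h₂.1)
      (ClosedIdeal.tmul_mem_tensor π₁ π₂ hgJ hhJ)
      fun _ hx => ClosedIdeal.mul_eq_of_mem_tensor π₁ π₂ hg hh hx,
    ClosedIdeal.IsCountablyGenerated.tensor π₁ π₂, ClosedIdeal.IsCountablyGenerated.tensor π₁ π₂⟩
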